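/- Work in the algebra $\mathbb{Q}\langle\langle x_1,x_2,\dots\rangle\rangle$ of formal power series in noncommuting variables. For a set partition $\pi$ of $[n]=\{1,\dots,n\}$ (written $\pi\vdash[n]$, $n\ge 0$), let $m_\pi$ (respectively $e_\pi$) be the sum of $x_{i_1}x_{i_2}\cdots x_{i_n}$ over all tuples $(i_1,\dots,i_n)$ of positive integers such that $i_j=i_k$ if and only if $j,k$ lie in the same block of $\pi$ (respectively $i_j\ne i_k$ whenever $j\neq k$ lie in the same block of $\pi$). Let $\lambda(\pi)$ be the list of block sizes of $\pi$ in weakly decreasing order, $\lambda(\pi)!$ the product of the factorials of the block sizes, and $h_\pi=\sum_{\sigma\vdash[n]}\lambda(\sigma\wedge\pi)!\,m_\sigma$, where $\sigma\wedge\pi$ is the greatest lower bound in the refinement order. The $h_\pi$, over all $n\ge0$ and $\pi\vdash[n]$, form a basis of the subalgebra $\mathrm{NCSym}$ spanned by the $m_\pi$; let $\omega:\mathrm{NCSym}\to\mathrm{NCSym}$ be the linear map with $\omega(h_\pi)=e_\pi$ for all $\pi$. A permutation $\delta\in\mathfrak{S}_n$ acts linearly on the homogeneous part of degree $n$ of $\mathrm{NCSym}$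 by $\delta\circ m_\pi=m_{\delta\pi}$. Write $[k]$ also for the set partition of $[k]$ with a single block (the empty one if $k=0$, so that $h_{[0]}=1$). For $\pi\vdash[n]$ with $\lambda(\pi)=\lambda_1\lambda_2\cdots\lambda_\ell$, let $\delta_\pi\in\mathfrak{S}_n$ be the permutation whose one-line notation is obtained by listing the blocks of $\pi$ by weakly decreasing size, blocks of equal size by increasing least element, and the elements of each block in increasing order. The standard Schur function $s_\pi$ and the transposed standard Schur function $s^t_\pi$ in noncommuting variables are $$s_\pi=\delta_\pi\circ\sum_{\varepsilon\in\mathfrak{S}_\ell}\operatorname{sgn}(\varepsilon)\,a_{1\varepsilon(1)}a_{2\varepsilon(2)}\cdots a_{\ell\varepsilon(\ell)},\qquad a_{ij}=\frac{1}{(\lambda_i-i+j)!}\,h_{[\lambda_i-i+j]},\qquad s^t_\pi=\omega(s_\pi),$$ where $a_{ij}=0$ if $\lambda_i-i+j<0$. **Proposition.** The Schur basis and the transposed Schur basis are different as sets: $$\{s_\pi\}_{\pi\vdash[n],\,n\ge1}\neq\{s^t_\pi\}_{\pi\vdash[n],\,n\ge1}.$$ More precisely, for every $n\ge3$ the function $s_{[n]}$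 is not of the form $s^t_\pi=\omega(s_\pi)$ for any set partition $\pi$ (of any size). -/

import Mathlib

open scoped Nat

/-! ### Formal power series in noncommuting variables -/

/-- `ℚ⟨⟨x₀, x₁, …⟩⟩`: rational formal power series in countably many noncommuting variables.
The monomial `x_{i₁} x_{i₂} ⋯ x_{iₙ}` is the word `[i₁, i₂, …, iₙ]`, and a series is given by its
coefficients, one for each word. -/
structure NCSeries where
  /-- the coefficient of a word -/
  coeff : List ℕ → ℚ

namespace NCSeries

instance : CoeFun NCSeries fun _ => List ℕ → ℚ := ⟨coeff⟩

/-- A series is the same as its coefficient function. -/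
def coeffEquiv : NCSeries ≃ (List ℕ → ℚ) where
  toFun := coeff
  invFun := mk

/-- Addition is coefficientwise. -/
instance : AddCommGroup NCSeries := coeffEquiv.addCommGroup

/-- Multiplication by rational scalars is coefficientwise. -/
instance : Module ℚ NCSeries := coeffEquiv.module ℚ

@[ext] theorem ext {f g : NCSeries} (h : ∀ w, f w = g w) : f = g :=
  coeffEquiv.injective (funext h)

@[simp] theorem mk_apply (c : List ℕ → ℚ) (w : List ℕ) : (mk c) w = c w := rfl

@[simp] theorem add_apply (f g : NCSeries) (w : List ℕ) : (f + g) w = f w + g w := rfl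

@[simp] theorem zero_apply (w : List ℕ) : (0 : NCSeries) w = 0 := rfl

@[simp] theorem smul_apply (c : ℚ) (f : NCSeries) (w : List ℕ) : (c • f) w = c * f w := rfl

theorem sum_apply {ι : Type*} (s : Finset ι) (f : ι → NCSeries) (w : List ℕ) :
    (∑ i ∈ s, f i) w = ∑ i ∈ s, f i w :=
  map_sum (⟨⟨fun f : NCSeries => f w, rfl⟩, fun _ _ => rfl⟩ : NCSeries →+ ℚ) f s

/-- The series `1`. -/
instance : One NCSeries := ⟨⟨fun w => if w = [] then 1 else 0⟩⟩

/-- The product of series: the coefficient of `w` in `f * g` is the sum of `f u * g v` over all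
factorizations `w = u v`. -/
instance : Mul NCSeries :=
  ⟨fun f g => ⟨fun w => ∑ k ∈ Finset.range (w.length + 1), f (w.take k) * g (w.drop k)⟩⟩

theorem one_apply (w : List ℕ) : (1 : NCSeries) w = if w = [] then 1 else 0 := rfl

theorem mul_apply (f g : NCSeries) (w : List ℕ) :
    (f * g) w = ∑ k ∈ Finset.range (w.length + 1), f (w.take k) * g (w.drop k) := rfl

theorem mul_nil (f g : NCSeries) : (f * g) [] = f [] * g [] := by
  simp [mul_apply]

/-- The series whose coefficient at `w` is the coefficient of `f` at `x_a w`. -/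
def shift (a : ℕ) (f : NCSeries) : NCSeries := ⟨fun w => f (a :: w)⟩

theorem mul_cons (f g : NCSeries) (a : ℕ) (w : List ℕ) :
    (f * g) (a :: w) = f [] * g (a :: w) + (shift a f * g) w := by
  simp only [mul_apply, List.length_cons]
  rw [Finset.sum_range_succ', add_comm]
  rfl

theorem shift_mul (f g : NCSeries) (a : ℕ) :
    shift a (f * g) = f [] • shift a g + shift a f * g := by
  ext w
  exact mul_cons f g a w

private theorem add_mul' (f g h : NCSeries) : (f + g) * h = f * h + g * h := by
  ext w
  simp [mul_apply, add_mul, Finset.sum_add_distrib]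

private theorem mul_add' (f g h : NCSeries) : f * (g + h) = f * g + f * h := by
  ext w
  simp [mul_apply, mul_add, Finset.sum_add_distrib]

protected theorem smul_mul (c : ℚ) (f g : NCSeries) : (c • f) * g = c • (f * g) := by
  ext w
  simp [mul_apply, mul_assoc, Finset.mul_sum]

protected theorem mul_smul (c : ℚ) (f g : NCSeries) : f * (c • g) = c • (f * g) := by
  ext w
  simp [mul_apply, mul_left_comm, Finset.mul_sum]

private theorem zero_mul' (f : NCSeries) : 0 * f = 0 := by
  ext w
  simp [mul_apply]

private theorem mul_zero' (f : NCSeries) : f * 0 = 0 := by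
  ext w
  simp [mul_apply]

private theorem mul_assoc_aux (w : List ℕ) :
    ∀ f g h : NCSeries, (f * g * h) w = (f * (g * h)) w := by
  induction w with
  | nil => intro f g h; simp [mul_nil, mul_assoc]
  | cons a w ih =>
    intro f g h
    rw [mul_cons, mul_cons, mul_nil, shift_mul, add_mul', add_apply, NCSeries.smul_mul,
      smul_apply, ih, mul_cons g h]
    ring

private theorem one_mul' (f : NCSeries) : 1 * f = f := by
  ext w
  cases w with
  | nil => simp [mul_nil, one_apply]
  | cons a w =>
    have : shift a 1 = 0 := by
      ext v
      simp [shift, one_apply]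
    rw [mul_cons, this, zero_mul']
    simp [one_apply]

private theorem mul_one_aux (w : List ℕ) : ∀ f : NCSeries, (f * 1) w = f w := by
  induction w with
  | nil => intro f; simp [mul_nil, one_apply]
  | cons a w ih =>
    intro f
    rw [mul_cons, ih]
    simp [one_apply, shift]

instance : Ring NCSeries :=
  { (inferInstance : AddCommGroup NCSeries) with
    mul := (· * ·)
    one := 1
    left_distrib := mul_add'
    right_distrib := add_mul'
    zero_mul := zero_mul'
    mul_zero := mul_zero'
    mul_assoc := fun f g h => ext fun w => mul_assoc_aux w f g h
    one_mul := one_mul'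
    mul_one := fun f => ext fun w => mul_one_aux w f }

open Classical in
/-- The series `∑ x_{i₁} x_{i₂} ⋯ x_{iₙ}` summed over all tuples `(i₁, …, iₙ)` that satisfy `P`
(different tuples give different monomials). -/
noncomputable def wordSum (n : ℕ) (P : (Fin n → ℕ) → Prop) : NCSeries :=
  ⟨fun w => if ∃ i : Fin n → ℕ, w = List.ofFn i ∧ P i then 1 else 0⟩

end NCSeries

/-- The noncommutative Leibniz determinant: the sum over all permutations `ε` of
`sgn(ε) a_{1ε(1)} a_{2ε(2)} ⋯ a_{nε(n)}`, the factors being multiplied from the top row to the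
bottom row. -/
def ncDet {R : Type*} [Ring R] {n : ℕ} (A : Matrix (Fin n) (Fin n) R) : R :=
  ∑ ε : Equiv.Perm (Fin n), Equiv.Perm.sign ε • (List.ofFn fun i => A i (ε i)).prod

/-! ### Set partitions -/

/-- Set partitions of `[n]` (the `n`-element set is `Fin n`). The order `≤` is refinement, `⊓` is
the greatest lower bound, and `π.part j` is the block of `π` that contains `j`. -/
abbrev SetPartition (n : ℕ) : Type := Finpartition (Finset.univ : Finset (Fin n))

namespace SetPartition

variable {n : ℕ}

/-- The set partition `[n]` with the single block `{1, …, n}` (with no block if `n = 0`). -/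
def single (n : ℕ) : SetPartition n := ⊤

/-- The integer partition `λ(π)`: the list of the block sizes of `π` in weakly decreasing order. -/
def shape (π : SetPartition n) : List ℕ :=
  (π.parts.val.map Finset.card).sort (· ≥ ·)

/-- `λ(π)!`, the product of the factorials of the block sizes. -/
def shapeFactorial (π : SetPartition n) : ℕ := ∏ B ∈ π.parts, (B.card)!

/-- The permutation `δ_π`. List the blocks of `π` in order of weakly decreasing size, blocks of the
same size in order of increasing least element, and the elements of each block in increasing
order. The `j`-th letter of the resulting word is `δ_π(j)`. So the elements `x` of `[n]` are sorted
by the size of the block of `x`, then by the least element of that block, then by `x` itself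
(`Tuple.sort` breaks ties in this way). -/
def readingPerm (π : SetPartition n) : Equiv.Perm (Fin n) :=
  Tuple.sort fun x : Fin n =>
    (toLex (OrderDual.toDual (π.part x).card, (π.part x).min) : ℕᵒᵈ ×ₗ WithTop (Fin n))

end SetPartition

/-! ### The algebra `NCSym` -/

section NCSym

open NCSeries SetPartition

variable {n : ℕ}

/-- The monomial symmetric function `m_π`: the sum over the tuples with `i_j = i_k` if and only if
`j` and `k` are in the same block of `π`. -/
noncomputable def ncM (π : SetPartition n) : NCSeries :=
  wordSum n fun i => ∀ j k, i j = i k ↔ π.part j = π.part k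

/-- The elementary symmetric function `e_π`: the sum over the tuples with `i_j ≠ i_k` whenever
`j ≠ k` are in the same block of `π`. -/
noncomputable def ncE (π : SetPartition n) : NCSeries :=
  wordSum n fun i => ∀ j k, j ≠ k → π.part j = π.part k → i j ≠ i k

/-- The complete homogeneous symmetric function `h_π = ∑_σ λ(σ ∧ π)! m_σ`. -/
noncomputable def ncH (π : SetPartition n) : NCSeries :=
  ∑ σ : SetPartition n, ((shapeFactorial (σ ⊓ π) : ℕ) : ℚ) • ncM σ

/-- `NCSym`, the linear span of all `m_π`, `π ⊢ [n]`, `n ≥ 0`, in the algebra of noncommutative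
formal power series. -/
noncomputable def NCSym : Submodule ℚ NCSeries :=
  Submodule.span ℚ (Set.range fun π : (Σ n : ℕ, SetPartition n) => ncM π.2)

/-- The permutation map on positions: `δ` sends `x_{i_1} ⋯ x_{i_n}` to
`x_{i_{δ⁻¹(1)}} ⋯ x_{i_{δ⁻¹(n)}}`, so that `δ ∘ b_π = b_{δπ}` for the bases `b = m, e, h`.
Components of degree other than `n` are left unchanged. -/
def permMap (δ : Equiv.Perm (Fin n)) : NCSeries →ₗ[ℚ] NCSeries where
  toFun f := ⟨fun w =>
    if hw : w.length = n then f (List.ofFn fun j : Fin n => w.get ((δ j).cast hw.symm)) else f w⟩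
  map_add' f g := by
    ext w
    by_cases hw : w.length = n <;> simp [hw]
  map_smul' c f := by
    ext w
    by_cases hw : w.length = n <;> simp [hw]

/-- The source Schur function `s_[λ]` of an integer partition `λ = λ₁ λ₂ ⋯ λ_ℓ`: the
noncommutative determinant of the matrix with entries `h_[λᵢ - i + j] / (λᵢ - i + j)!`, an entry
with a negative index being `0`. -/
noncomputable def sourceSchur (l : List ℕ) : NCSeries :=
  ncDet (Matrix.of fun i j : Fin l.length =>
    if (l.get i : ℤ) - (i : ℕ) + (j : ℕ) < 0 then 0
    else (1 / (((l.get i : ℤ) - (i : ℕ) + (j : ℕ)).toNat ! : ℚ)) •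
      ncH (single ((l.get i : ℤ) - (i : ℕ) + (j : ℕ)).toNat))

/-! #### Membership in `NCSym` -/

theorem permMap_apply_ofFn (δ : Equiv.Perm (Fin n)) (f : NCSeries) (i : Fin n → ℕ) :
    permMap δ f (List.ofFn i) = f (List.ofFn fun j => i (δ j)) := by
  simp [permMap]

theorem wordSum_apply_ofFn (P : (Fin n → ℕ) → Prop) (i : Fin n → ℕ) [Decidable (P i)] :
    wordSum n P (List.ofFn i) = if P i then 1 else 0 := by
  have : (∃ i' : Fin n → ℕ, List.ofFn i = List.ofFn i' ∧ P i') ↔ P i := by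
    constructor
    · rintro ⟨i', h, h'⟩
      rwa [List.ofFn_injective h]
    · exact fun h => ⟨i, rfl, h⟩
  simp only [wordSum, NCSeries.mk_apply, this]

theorem wordSum_of_length_ne (P : (Fin n → ℕ) → Prop) (w : List ℕ) (hw : w.length ≠ n) :
    wordSum n P w = 0 := by
  simp only [wordSum, NCSeries.mk_apply]
  rw [if_neg]
  rintro ⟨i, rfl, -⟩
  simp at hw

/-- The series is homogeneous of degree `n`, and renaming the variables injectively does not change
its coefficients. -/
def HomogSymm (n : ℕ) (f : NCSeries) : Prop :=
  (∀ w : List ℕ, w.length ≠ n → f w = 0) ∧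
    ∀ (w : List ℕ) (r : ℕ → ℕ), Set.InjOn r {x | x ∈ w} → f (w.map r) = f w

theorem homogSymm_wordSum (P : (Fin n → ℕ) → Prop)
    (hP : ∀ i i' : Fin n → ℕ, (∀ j k, i j = i k ↔ i' j = i' k) → (P i ↔ P i')) :
    HomogSymm n (wordSum n P) := by
  classical
  refine ⟨wordSum_of_length_ne P, fun w r hr => ?_⟩
  by_cases hw : w.length = n
  · subst hw
    have h1 : w = List.ofFn w.get := (List.ofFn_get w).symm
    have h2 : w.map r = List.ofFn (r ∘ w.get) := by
      rw [← List.map_ofFn, ← h1]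
    have h3 : wordSum w.length P w = wordSum w.length P (List.ofFn w.get) := by
      rw [List.ofFn_get]
    rw [h2, h3, wordSum_apply_ofFn, wordSum_apply_ofFn]
    have := hP (r ∘ w.get) w.get (fun j k => hr.eq_iff (List.get_mem _ _) (List.get_mem _ _))
    simp [this]
  · rw [wordSum_of_length_ne P w hw, wordSum_of_length_ne P _ (by simpa using hw)]

theorem homogSymm_ncM (π : SetPartition n) : HomogSymm n (ncM π) :=
  homogSymm_wordSum _ fun i i' h => by simp [h]

theorem homogSymm_ncE (π : SetPartition n) : HomogSymm n (ncE π) :=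
  homogSymm_wordSum _ fun i i' h => by simp [h]

/-- A tuple whose equalities are exactly those forced by the blocks of `π`. -/
noncomputable def blockWord (π : SetPartition n) : Fin n → ℕ :=
  fun j => (Fintype.equivFin (Finset (Fin n)) (π.part j) : ℕ)

theorem blockWord_eq_iff (π : SetPartition n) (j k : Fin n) :
    blockWord π j = blockWord π k ↔ π.part j = π.part k := by
  simp [blockWord, Fin.val_inj]

theorem part_eq_iff (π : SetPartition n) (j k : Fin n) :
    π.part j = π.part k ↔ j ∈ π.part k :=
  (π.mem_part_iff_part_eq_part (Finset.mem_univ _) (Finset.mem_univ _)).symm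

theorem setPartition_ext {π σ : SetPartition n}
    (h : ∀ j k, π.part j = π.part k ↔ σ.part j = σ.part k) : π = σ := by
  have hp : ∀ j, π.part j = σ.part j := fun j => by
    ext k
    rw [← part_eq_iff, ← part_eq_iff]
    exact h k j
  have key : ∀ τ : SetPartition n, τ.parts = Finset.univ.image τ.part := fun τ => by
    ext B
    simp only [Finset.mem_image, Finset.mem_univ, true_and]
    constructor
    · intro hB
      obtain ⟨x, hx⟩ := τ.nonempty_of_mem_parts hB
      exact ⟨x, τ.part_eq_of_mem hB hx⟩
    · rintro ⟨x, rfl⟩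
      exact τ.part_mem.2 (Finset.mem_univ _)
  apply Finpartition.ext
  rw [key, key, funext hp]

theorem ncM_blockWord (σ π : SetPartition n) :
    ncM σ (List.ofFn (blockWord π)) = if σ = π then 1 else 0 := by
  classical
  rw [ncM, wordSum_apply_ofFn]
  congr 1
  simp only [blockWord_eq_iff, eq_iff_iff]
  exact ⟨fun h => setPartition_ext fun j k => (h j k).symm, fun h => by simp [h]⟩

theorem exists_same_kernel (i : Fin n → ℕ) :
    ∃ π : SetPartition n, ∀ j k, i j = i k ↔ π.part j = π.part k := by
  classical
  refine ⟨Finpartition.ofSetoid (Setoid.ker i), fun j k => ?_⟩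
  rw [part_eq_iff, Finpartition.mem_part_ofSetoid_iff_rel, Setoid.ker_def, eq_comm]

theorem HomogSymm.apply_eq {f : NCSeries} (hf : HomogSymm n f) {i i' : Fin n → ℕ}
    (h : ∀ j k, i j = i k ↔ i' j = i' k) : f (List.ofFn i) = f (List.ofFn i') := by
  have hfac : Function.FactorsThrough i' i := fun j k hjk => (h j k).1 hjk
  have hext : Function.extend i i' (fun _ => 0) ∘ i = i' :=
    funext fun j => hfac.extend_apply _ j
  rw [← hf.2 (List.ofFn i) (Function.extend i i' fun _ => 0), List.map_ofFn, hext]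
  intro x hx y hy hxy
  obtain ⟨j, rfl⟩ := (List.mem_ofFn' i x).1 hx
  obtain ⟨k, rfl⟩ := (List.mem_ofFn' i y).1 hy
  rw [hfac.extend_apply, hfac.extend_apply] at hxy
  exact (h j k).2 hxy

theorem HomogSymm.eq_sum {f : NCSeries} (hf : HomogSymm n f) :
    f = ∑ π : SetPartition n, f (List.ofFn (blockWord π)) • ncM π := by
  classical
  ext w
  rw [NCSeries.sum_apply]
  by_cases hw : w.length = n
  · subst hw
    obtain ⟨π, hπ⟩ := exists_same_kernel w.get
    have hk : ∀ j k, w.get j = w.get k ↔ blockWord π j = blockWord π k := fun j k => by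
      rw [hπ, blockWord_eq_iff]
    have h1 : ∀ g : NCSeries, HomogSymm w.length g → g w = g (List.ofFn (blockWord π)) := by
      intro g hg
      rw [← hg.apply_eq hk, List.ofFn_get]
    rw [h1 f hf]
    simp only [smul_apply, h1 _ (homogSymm_ncM _), ncM_blockWord]
    simp
  · rw [hf.1 w hw]
    simp [(homogSymm_ncM _).1 w hw]

theorem ncM_mem (π : SetPartition n) : ncM π ∈ NCSym :=
  Submodule.subset_span ⟨⟨n, π⟩, rfl⟩

theorem HomogSymm.mem {f : NCSeries} (hf : HomogSymm n f) : f ∈ NCSym := by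
  rw [hf.eq_sum]
  exact Submodule.sum_mem _ fun π _ => Submodule.smul_mem _ _ (ncM_mem π)

theorem ncE_mem (π : SetPartition n) : ncE π ∈ NCSym := (homogSymm_ncE π).mem

theorem ncH_mem (π : SetPartition n) : ncH π ∈ NCSym :=
  Submodule.sum_mem _ fun σ _ => Submodule.smul_mem _ _ (ncM_mem σ)

theorem HomogSymm.mul {m : ℕ} {f g : NCSeries} (hf : HomogSymm n f) (hg : HomogSymm m g) :
    HomogSymm (n + m) (f * g) := by
  constructor
  · intro w hw
    rw [mul_apply]
    refine Finset.sum_eq_zero fun k hk => ?_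
    by_cases h1 : (w.take k).length = n
    · rw [hg.1 (w.drop k), mul_zero]
      simp only [List.length_take, List.length_drop, Finset.mem_range] at *
      omega
    · rw [hf.1 _ h1, zero_mul]
  · intro w r hr
    simp only [mul_apply, List.length_map]
    refine Finset.sum_congr rfl fun k _ => ?_
    rw [← List.map_take, ← List.map_drop,
      hf.2 _ _ (hr.mono fun x hx => List.mem_of_mem_take hx),
      hg.2 _ _ (hr.mono fun x hx => List.mem_of_mem_drop hx)]

theorem NCSym.mul_mem {f g : NCSeries} (hf : f ∈ NCSym) (hg : g ∈ NCSym) : f * g ∈ NCSym := by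
  refine Submodule.span_induction ?_ ?_ ?_ ?_ hf
  · rintro _ ⟨π, rfl⟩
    refine Submodule.span_induction ?_ ?_ ?_ ?_ hg
    · rintro _ ⟨σ, rfl⟩
      exact ((homogSymm_ncM π.2).mul (homogSymm_ncM σ.2)).mem
    · rw [mul_zero]
      exact Submodule.zero_mem _
    · intro x y _ _ hx hy
      rw [mul_add]
      exact Submodule.add_mem _ hx hy
    · intro c x _ hx
      rw [NCSeries.mul_smul]
      exact Submodule.smul_mem _ _ hx
  · rw [zero_mul]
    exact Submodule.zero_mem _
  · intro x y _ _ hx hy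
    rw [add_mul]
    exact Submodule.add_mem _ hx hy
  · intro c x _ hx
    rw [NCSeries.smul_mul]
    exact Submodule.smul_mem _ _ hx

theorem NCSym.one_mem : (1 : NCSeries) ∈ NCSym := by
  refine HomogSymm.mem (n := 0) ⟨fun w hw => ?_, fun w r _ => ?_⟩
  · rw [one_apply, if_neg]
    rintro rfl
    exact hw rfl
  · simp [one_apply]

theorem HomogSymm.permMap {m : ℕ} {f : NCSeries} (hf : HomogSymm m f)
    (δ : Equiv.Perm (Fin n)) : HomogSymm m (permMap δ f) := by
  constructor
  · intro w hw
    by_cases h : w.length = n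
    · simp only [_root_.permMap, LinearMap.coe_mk, AddHom.coe_mk, NCSeries.mk_apply, dif_pos h]
      exact hf.1 _ (by rw [List.length_ofFn, ← h]; exact hw)
    · simp only [_root_.permMap, LinearMap.coe_mk, AddHom.coe_mk, NCSeries.mk_apply, dif_neg h]
      exact hf.1 _ hw
  · intro w r hr
    by_cases h : w.length = n
    · subst h
      have h1 : w.map r = List.ofFn (r ∘ w.get) := by
        rw [← List.map_ofFn, List.ofFn_get]
      have h2 : _root_.permMap δ f w = f (List.ofFn fun j => w.get (δ j)) := by simp [_root_.permMap]
      rw [h1, permMap_apply_ofFn, h2, ← hf.2 (List.ofFn fun j => w.get (δ j)) r, List.map_ofFn]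
      · rfl
      · refine hr.mono fun x hx => ?_
        obtain ⟨j, rfl⟩ := (List.mem_ofFn' _ x).1 hx
        exact List.get_mem _ _
    · have h' : ¬ (w.map r).length = n := by simpa using h
      simp only [_root_.permMap, LinearMap.coe_mk, AddHom.coe_mk, NCSeries.mk_apply, dif_neg h, dif_neg h']
      exact hf.2 w r hr

theorem permMap_mem (δ : Equiv.Perm (Fin n)) {f : NCSeries} (hf : f ∈ NCSym) :
    permMap δ f ∈ NCSym := by
  refine Submodule.span_induction ?_ ?_ ?_ ?_ hf
  · rintro _ ⟨π, rfl⟩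
    exact ((homogSymm_ncM π.2).permMap δ).mem
  · rw [map_zero]
    exact Submodule.zero_mem _
  · intro x y _ _ hx hy
    rw [map_add]
    exact Submodule.add_mem _ hx hy
  · intro c x _ hx
    rw [map_smul]
    exact Submodule.smul_mem _ _ hx

theorem ncDet_mem {k : ℕ} (A : Matrix (Fin k) (Fin k) NCSeries) (hA : ∀ i j, A i j ∈ NCSym) :
    ncDet A ∈ NCSym := by
  refine Submodule.sum_mem _ fun ε _ => ?_
  have hl : ∀ l : List NCSeries, (∀ f ∈ l, f ∈ NCSym) → l.prod ∈ NCSym := by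
    intro l
    induction l with
    | nil => intro _; simpa using NCSym.one_mem
    | cons f l ih =>
      intro h
      rw [List.prod_cons]
      exact NCSym.mul_mem (h f (by simp)) (ih fun g hg => h g (by simp [hg]))
  have hp : (List.ofFn fun i => A i (ε i)).prod ∈ NCSym := by
    apply hl
    intro f hf
    obtain ⟨i, rfl⟩ := (List.mem_ofFn' _ f).1 hf
    exact hA _ _
  rcases Int.units_eq_one_or (Equiv.Perm.sign ε) with h | h
  · rw [h, one_smul]
    exact hp
  · rw [h, Units.neg_smul, one_smul]
    exact Submodule.neg_mem _ hp

theorem sourceSchur_mem (l : List ℕ) : sourceSchur l ∈ NCSym := by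
  refine ncDet_mem _ fun i j => ?_
  rw [Matrix.of_apply]
  split_ifs
  · exact Submodule.zero_mem _
  · exact Submodule.smul_mem _ _ (ncH_mem _)

/-- The permutation map acts on the monomial basis through the action of permutations on set
partitions: if `σ = δπ` then `δ ∘ m_π = m_σ`. -/
theorem permMap_ncM (δ : Equiv.Perm (Fin n)) (π σ : SetPartition n)
    (h : ∀ j k, σ.part (δ j) = σ.part (δ k) ↔ π.part j = π.part k) :
    permMap δ (ncM π) = ncM σ := by
  classical
  ext w
  by_cases hw : w.length = n
  · subst hw
    have h2 : ∀ f, permMap δ f w = f (List.ofFn fun j => w.get (δ j)) := fun f => by simp [_root_.permMap]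
    have h3 : ncM σ w = ncM σ (List.ofFn w.get) := by rw [List.ofFn_get]
    rw [h2, h3, ncM, ncM, wordSum_apply_ofFn, wordSum_apply_ofFn]
    congr 1
    rw [eq_iff_iff]
    constructor
    · intro H j k
      have := H (δ.symm j) (δ.symm k)
      rw [← h] at this
      simpa using this
    · intro H j k
      rw [← h]
      exact H _ _
  · rw [((homogSymm_ncM π).permMap δ).1 w hw, (homogSymm_ncM σ).1 w hw]

/-! #### The `h`-basis and the involution `ω` -/

theorem part_inf_eq_iff (σ π : SetPartition n) (j k : Fin n) :
    (σ ⊓ π).part j = (σ ⊓ π).part k ↔ σ.part j = σ.part k ∧ π.part j = π.part k := by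
  have key : ∀ x, (σ ⊓ π).part x = σ.part x ⊓ π.part x := fun x => by
    apply Finpartition.part_eq_of_mem
    · rw [Finpartition.parts_inf, Finset.mem_erase, Finset.mem_image]
      refine ⟨?_, (σ.part x, π.part x), ?_, rfl⟩
      · apply Finset.Nonempty.ne_empty
        exact ⟨x, by simp⟩
      · simp
    · simp
  constructor
  · intro h
    have hj : j ∈ (σ ⊓ π).part k := by
      rw [← part_eq_iff]; exact h
    rw [key] at hj
    rw [part_eq_iff, part_eq_iff]
    exact Finset.mem_inter.1 hj
  · rintro ⟨h1, h2⟩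
    rw [key, key, h1, h2]

/-- `λ(π)!` counts the permutations that fix every block of `π`. -/
theorem shapeFactorial_eq_card (π : SetPartition n) :
    shapeFactorial π =
      Fintype.card {g : Equiv.Perm (Fin n) // ∀ x, π.part (g x) = π.part x} := by
  classical
  have h1 := DomMulAct.stabilizer_card (f := π.part)
  have h2 : Fintype.card {g : Equiv.Perm (Fin n) // ∀ x, π.part (g x) = π.part x} =
      Fintype.card {g : Equiv.Perm (Fin n) // π.part ∘ g = π.part} :=
    Fintype.card_congr (Equiv.subtypeEquivRight fun g => by simp [funext_iff])
  rw [h2, h1, shapeFactorial]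
  rw [← Finset.prod_subset (Finset.subset_univ π.parts)]
  · refine Finset.prod_congr rfl fun B hB => ?_
    congr 1
    rw [Fintype.card_subtype]
    congr 1
    ext x
    simp [π.part_eq_iff_mem hB]
  · intro B _ hB
    rw [Fintype.card_eq_zero_iff.2, Nat.factorial_zero]
    exact ⟨fun x => hB (x.2 ▸ π.part_mem.2 (Finset.mem_univ _))⟩

theorem le_of_part (ρ π : SetPartition n)
    (h : ∀ x y, ρ.part x = ρ.part y → π.part x = π.part y) : ρ ≤ π := by
  intro B hB
  obtain ⟨x, hx⟩ := ρ.nonempty_of_mem_parts hB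
  refine ⟨π.part x, π.part_mem.2 (Finset.mem_univ _), fun y hy => ?_⟩
  rw [← part_eq_iff]
  exact h y x (by rw [ρ.part_eq_of_mem hB hx, ρ.part_eq_of_mem hB hy])

theorem part_of_le {ρ π : SetPartition n} (h : ρ ≤ π) {x y : Fin n}
    (hxy : ρ.part x = ρ.part y) : π.part x = π.part y := by
  obtain ⟨C, hC, hle⟩ := h (ρ.part_mem.2 (Finset.mem_univ x))
  have hx : x ∈ C := hle (by simp)
  have hy : y ∈ C := hle ((part_eq_iff ρ y x).1 hxy.symm)
  rw [π.part_eq_of_mem hC hx, π.part_eq_of_mem hC hy]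

/-- There is a permutation whose cycles are the blocks of `ρ`; it fixes the blocks of `π` if and
only if `ρ ≤ π`. -/
theorem exists_perm_blocks (ρ : SetPartition n) :
    ∃ g : Equiv.Perm (Fin n), ∀ π : SetPartition n,
      (∀ x, π.part (g x) = π.part x) ↔ ρ ≤ π := by
  classical
  have hc : ∀ B : Finset (Fin n), ∃ c : Equiv.Perm {x : Fin n // ρ.part x = B},
      ∀ x y, c.SameCycle x y := by
    intro B
    obtain ⟨c, hc, -⟩ :=
      (Finset.univ : Finset {x : Fin n // ρ.part x = B}).exists_cycleOn
    exact ⟨c, fun x y => hc.2 (by simp) (by simp)⟩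
  choose c hc using hc
  let E := Equiv.sigmaFiberEquiv ρ.part
  let g : Equiv.Perm (Fin n) := (E.symm.trans (Equiv.sigmaCongrRight c)).trans E
  have hg : ∀ B (x : {x : Fin n // ρ.part x = B}), g x.1 = (c B x).1 := by
    rintro B ⟨x, rfl⟩
    rfl
  refine ⟨g, fun π => ⟨fun h => le_of_part _ _ fun x y hxy => ?_, fun h x => ?_⟩⟩
  · have hpow : ∀ (k : ℕ) (z : {z : Fin n // ρ.part z = ρ.part x}),
        π.part ((c (ρ.part x) ^ k) z).1 = π.part z.1 := by
      intro k
      induction k with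
      | zero => intro z; rfl
      | succ k ih =>
        intro z
        rw [pow_succ', Equiv.Perm.mul_apply, ← hg, h, ih]
    obtain ⟨k, hk⟩ := (hc (ρ.part x) ⟨x, rfl⟩ ⟨y, hxy.symm⟩).exists_nat_pow_eq
    have := hpow k ⟨x, rfl⟩
    rw [hk] at this
    exact this.symm
  · apply part_of_le h
    have := hg (ρ.part x) ⟨x, rfl⟩
    rw [this]
    exact (c (ρ.part x) ⟨x, rfl⟩).2

/-- The matrix `(λ(σ ∧ π)!)` that expresses the `h_π` through the `m_σ` is nonsingular. -/
theorem shapeFactorial_nonsingular (a : SetPartition n → ℚ)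
    (ha : ∀ σ, ∑ π, ((shapeFactorial (σ ⊓ π) : ℕ) : ℚ) * a π = 0) : a = 0 := by
  classical
  let F : SetPartition n → Equiv.Perm (Fin n) → ℚ := fun π g =>
    if ∀ x, π.part (g x) = π.part x then 1 else 0
  have hF : ∀ σ π, ((shapeFactorial (σ ⊓ π) : ℕ) : ℚ) = ∑ g, F σ g * F π g := by
    intro σ π
    rw [shapeFactorial_eq_card, Fintype.card_subtype, Finset.card_filter, Nat.cast_sum]
    refine Finset.sum_congr rfl fun g _ => ?_
    simp only [F, part_inf_eq_iff, forall_and]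
    split_ifs <;> simp_all
  have hsq : ∑ g, (∑ π, F π g * a π) ^ 2 = 0 := by
    have h0 : ∑ σ, a σ * ∑ π, ((shapeFactorial (σ ⊓ π) : ℕ) : ℚ) * a π = 0 := by
      simp [ha]
    rw [← h0]
    simp only [hF, sq, Finset.sum_mul, Finset.mul_sum]
    rw [Finset.sum_comm]
    refine Finset.sum_congr rfl fun σ _ => ?_
    rw [Finset.sum_comm]
    refine Finset.sum_congr rfl fun π _ => Finset.sum_congr rfl fun g _ => ?_
    ring
  have hz : ∀ g, ∑ π, F π g * a π = 0 := by
    intro g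
    have := (Finset.sum_eq_zero_iff_of_nonneg fun g _ => sq_nonneg _).1 hsq g (Finset.mem_univ g)
    simpa using this
  funext ρ
  induction ρ using WellFoundedGT.induction with
  | ind ρ ih =>
    obtain ⟨g, hg⟩ := exists_perm_blocks ρ
    have := hz g
    rw [Finset.sum_eq_single ρ] at this
    · simpa [F, (hg ρ).2 le_rfl] using this
    · intro π _ hne
      by_cases hle : ρ ≤ π
      · rw [ih π (lt_of_le_of_ne hle (Ne.symm hne))]
        simp
      · simp only [F, hg π, if_neg hle, zero_mul]
    · simp

theorem ncH_blockWord (σ π : SetPartition n) :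
    ncH π (List.ofFn (blockWord σ)) = (shapeFactorial (σ ⊓ π) : ℕ) := by
  classical
  simp [ncH, NCSeries.sum_apply, ncM_blockWord]

theorem ncH_of_length_ne (π : SetPartition n) (w : List ℕ) (hw : w.length ≠ n) :
    ncH π w = 0 := by
  simp [ncH, NCSeries.sum_apply, (homogSymm_ncM _).1 w hw]

/-- The elements `h_π`, indexed by all set partitions, as elements of `NCSym`. -/
noncomputable def ncHFamily (π : Σ n : ℕ, SetPartition n) : NCSym := ⟨ncH π.2, ncH_mem π.2⟩

theorem linearIndependent_ncHFamily : LinearIndependent ℚ ncHFamily := by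
  classical
  rw [linearIndependent_iff]
  intro l hl
  have hl' : ∀ w, ∑ p ∈ l.support, l p * ncH p.2 w = 0 := by
    intro w
    have h1 := congrArg (fun f : NCSym => (f : NCSeries) w) hl
    simp only [Finsupp.linearCombination_apply, Finsupp.sum, Submodule.coe_sum,
      Submodule.coe_smul, NCSeries.sum_apply, NCSeries.smul_apply] at h1
    exact h1
  ext ⟨n, π⟩
  refine congrFun (shapeFactorial_nonsingular (fun π : SetPartition n => l ⟨n, π⟩) ?_) π
  intro σ
  rw [← hl' (List.ofFn (blockWord σ))]
  rw [Finset.sum_subset (Finset.subset_union_left (s₂ := Finset.univ.image (Sigma.mk n)))]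
  · rw [← Finset.sum_subset (Finset.subset_union_right (s₁ := l.support)
      (s₂ := Finset.univ.image (Sigma.mk n))), Finset.sum_image]
    · refine Finset.sum_congr rfl fun π _ => ?_
      rw [ncH_blockWord, mul_comm]
    · intro x _ y _ h
      simpa using h
    · rintro ⟨m, τ⟩ _ hm
      rw [ncH_of_length_ne, mul_zero]
      rw [List.length_ofFn]
      rintro rfl
      exact hm (by simp)
  · intro p _ hp
    rw [Finsupp.notMem_support_iff.1 hp, zero_mul]

theorem span_ncHFamily : ⊤ ≤ Submodule.span ℚ (Set.range ncHFamily) := by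
  classical
  have key : NCSym ≤ (Submodule.span ℚ (Set.range ncHFamily)).map NCSym.subtype := by
    refine Submodule.span_le.2 ?_
    rintro _ ⟨⟨n, σ⟩, rfl⟩
    let H : Matrix (SetPartition n) (SetPartition n) ℚ :=
      Matrix.of fun σ π => ((shapeFactorial (σ ⊓ π) : ℕ) : ℚ)
    have hinj : Function.Injective H.mulVec := by
      rw [← Matrix.coe_mulVecLin, ← LinearMap.ker_eq_bot, LinearMap.ker_eq_bot']
      intro a ha
      exact shapeFactorial_nonsingular a fun σ => congrFun ha σ
    have hu : IsUnit H := Matrix.mulVec_injective_iff_isUnit.1 hinj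
    have hm : ncM σ = ∑ π, H⁻¹ π σ • ncH π := by
      have hmul : H * H⁻¹ = 1 := Matrix.mul_nonsing_inv H ((Matrix.isUnit_iff_isUnit_det H).1 hu)
      simp only [ncH, Finset.smul_sum, smul_smul]
      rw [Finset.sum_comm]
      simp only [← Finset.sum_smul]
      rw [Finset.sum_eq_single σ]
      · have := congrFun (congrFun hmul σ) σ
        rw [Matrix.mul_apply, Matrix.one_apply_eq] at this
        simp only [H, Matrix.of_apply] at this
        simp only [H, mul_comm, this, one_smul]
      · intro τ _ hτ
        have := congrFun (congrFun hmul τ) σ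
        rw [Matrix.mul_apply, Matrix.one_apply_ne hτ] at this
        simp only [H, Matrix.of_apply] at this
        simp only [H, mul_comm, this, zero_smul]
      · simp
    change ncM σ ∈ _
    rw [hm]
    refine Submodule.sum_mem _ fun π _ => Submodule.smul_mem _ _ ?_
    exact ⟨ncHFamily ⟨n, π⟩, Submodule.subset_span ⟨_, rfl⟩, rfl⟩
  rintro f -
  obtain ⟨g, hg, hgf⟩ := key f.2
  rwa [← Subtype.ext hgf]

/-- The `h`-basis of `NCSym`. -/
noncomputable def hBasis : Module.Basis (Σ n : ℕ, SetPartition n) ℚ NCSym :=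
  Module.Basis.mk linearIndependent_ncHFamily span_ncHFamily

/-- The map `ω` on `NCSym`: the linear map with `ω(h_π) = e_π` for all set partitions `π`. -/
noncomputable def ncOmega : NCSym →ₗ[ℚ] NCSym :=
  hBasis.constr ℚ fun π => ⟨ncE π.2, ncE_mem π.2⟩

theorem ncOmega_ncH (π : SetPartition n) :
    ncOmega ⟨ncH π, ncH_mem π⟩ = ⟨ncE π, ncE_mem π⟩ := by
  have h := hBasis.constr_basis ℚ
    (fun π : (Σ n : ℕ, SetPartition n) => (⟨ncE π.2, ncE_mem π.2⟩ : NCSym)) ⟨n, π⟩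
  rw [hBasis, Module.Basis.mk_apply] at h
  exact h

/-! #### Schur functions in noncommuting variables -/

/-- The standard Schur function `s_π = δ_π ∘ s_[λ(π)]`. -/
noncomputable def ncSchur (π : SetPartition n) : NCSym :=
  ⟨permMap (readingPerm π) (sourceSchur (shape π)), permMap_mem _ (sourceSchur_mem _)⟩

/-- The transposed standard Schur function `s^t_π = ω(s_π)`. -/
noncomputable def ncSchurTransposed (π : SetPartition n) : NCSym := ncOmega (ncSchur π)

end NCSym

/-!
The function `s_[n]` is `h_[n] / n!`, while `s^t_π` is, up to a permutation of positions, the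
noncommutative determinant of the matrix with entries `e_[λᵢ - i + j] / (λᵢ - i + j)!`, where
`λ = λ(π)` (`coe_ncOmega_ncSchur`). The two are told apart by two coefficients.

* At `x₀ⁿ` the coefficient of `s_[n]` is `1`. If `λ₁ ≥ 2`, every term of the `e`-determinant starts
  with a factor `e_[k]`, `k ≥ 2`, which has no monomial `x₀ᵏ`, so the coefficient there is `0`
  (`jacobiTrudi_replicate_eq_zero`). Hence all parts of `λ` are `1`, and by degree there are `n` of
  them.
* At `x₀ⁿ⁻¹ x₁`, and at all rearrangements of this word, the coefficient of `s_[n]` is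
  `(n - 1)! / n! = 1 / n`. In the `e`-determinant of shape `1ⁿ` only the identity and the
  transposition of the last two columns contribute, and the coefficient is `1 - 1 / 2`
  (`jacobiTrudi_one_apply`). For `n ≥ 3` these differ.

For the description of `s^t_π`, `ω` has to be computed on permuted products of the `h_[k]`. For a
word `c` of colours, `zipSeries f c` is the series whose coefficient at `w` is `f` of the list of
pairs `(c_j, w_j)`. The product of the factorials of the multiplicities yields `h_π`, and the
indicator of lists without repetition yields `e_π`, where `π` is the partition into colour classes
(`zipSeries_eq`). Both functions of lists are multiplicative on disjoint concatenations and
invariant under rearrangement, so products (with disjoint sets of colours) and permutations of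
positions act on the colours alone, in the same way for `h` and `e`.
-/

open NCSeries SetPartition

/-! ### Products and permutations of coloured series -/

theorem mul_apply_of_degree {f : NCSeries} (g : NCSeries) {d : ℕ}
    (hf : ∀ w : List ℕ, w.length ≠ d → f w = 0) (w : List ℕ) :
    (f * g) w = if d ≤ w.length then f (w.take d) * g (w.drop d) else 0 := by
  rw [mul_apply]
  split_ifs with h
  · refine Finset.sum_eq_single_of_mem d (by simp; omega) fun k hk hkd => ?_
    rw [hf, zero_mul]
    simp only [Finset.mem_range, List.length_take] at *
    omega
  · refine Finset.sum_eq_zero fun k hk => ?_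
    rw [hf, zero_mul]
    simp only [Finset.mem_range, List.length_take] at *
    omega

/-- The product of the factorials of the multiplicities of the entries of a list. -/
def multFactorial {α : Type*} [DecidableEq α] (z : List α) : ℚ :=
  ∏ p ∈ z.toFinset, ((z.count p)! : ℚ)

/-- The indicator function of the lists without repeated entries. -/
def nodupIndicator {α : Type*} [DecidableEq α] (z : List α) : ℚ := if z.Nodup then 1 else 0

section

variable {α : Type*} [DecidableEq α]

theorem multFactorial_perm {z z' : List α} (h : z.Perm z') :
    multFactorial z = multFactorial z' := by
  rw [multFactorial, multFactorial, List.toFinset_eq_of_perm _ _ h]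
  simp only [h.count_eq]

theorem nodupIndicator_perm {z z' : List α} (h : z.Perm z') :
    nodupIndicator z = nodupIndicator z' := by
  simp only [nodupIndicator, h.nodup_iff]

theorem multFactorial_append {z z' : List α} (h : z.Disjoint z') :
    multFactorial (z ++ z') = multFactorial z * multFactorial z' := by
  rw [multFactorial, List.toFinset_append,
    Finset.prod_union (List.disjoint_toFinset_iff_disjoint.2 h)]
  congr 1
  · refine Finset.prod_congr rfl fun p hp => ?_
    rw [List.count_append, List.count_eq_zero_of_not_mem (l := z') (h (List.mem_toFinset.1 hp)),
      add_zero]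
  · refine Finset.prod_congr rfl fun p hp => ?_
    rw [List.count_append, List.count_eq_zero_of_not_mem (l := z)
      (fun hz => h hz (List.mem_toFinset.1 hp)), zero_add]

theorem nodupIndicator_append {z z' : List α} (h : z.Disjoint z') :
    nodupIndicator (z ++ z') = nodupIndicator z * nodupIndicator z' := by
  simp only [nodupIndicator, List.nodup_append', h, and_true]
  split_ifs <;> simp_all

theorem multFactorial_replicate (k : ℕ) (a : α) :
    multFactorial (List.replicate k a) = (k ! : ℕ) := by
  rcases Nat.eq_zero_or_pos k with rfl | hk
  · simp [multFactorial]
  · rw [multFactorial, List.toFinset_replicate_of_ne_zero hk.ne']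
    simp

theorem multFactorial_map {β : Type*} [DecidableEq β] {g : α → β}
    (hg : Function.Injective g) (z : List α) : multFactorial (z.map g) = multFactorial z := by
  have hi : (z.map g).toFinset = z.toFinset.image g := by
    ext
    simp
  rw [multFactorial, multFactorial, hi, Finset.prod_image hg.injOn]
  simp only [List.count_map_of_injective _ _ hg]

end

/-- The series attached to a word `c` of colours: the coefficient of a word `w` of the same length
is `f` of the list of pairs `(c_j, w_j)`. -/
def zipSeries (f : List (ℕ × ℕ) → ℚ) (c : List ℕ) : NCSeries :=
  ⟨fun w => if w.length = c.length then f (c.zip w) else 0⟩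

theorem zipSeries_apply (f : List (ℕ × ℕ) → ℚ) (c w : List ℕ) :
    zipSeries f c w = if w.length = c.length then f (c.zip w) else 0 := rfl

theorem zipSeries_mul {f : List (ℕ × ℕ) → ℚ}
    (hf : ∀ z z' : List (ℕ × ℕ), z.Disjoint z' → f (z ++ z') = f z * f z')
    {c d : List ℕ} (h : c.Disjoint d) :
    zipSeries f c * zipSeries f d = zipSeries f (c ++ d) := by
  ext w
  rw [mul_apply_of_degree (d := c.length) _ fun w hw => by rw [zipSeries_apply, if_neg hw]]
  simp only [zipSeries_apply, List.length_append, List.length_take, List.length_drop]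
  by_cases hw : w.length = c.length + d.length
  · rw [if_pos (by omega), if_pos (by omega), if_pos (by omega), if_pos hw, ← hf,
      ← List.zip_append (by simp; omega), List.take_append_drop]
    rintro ⟨a, b⟩ h1 h2
    exact h (List.of_mem_zip h1).1 (List.of_mem_zip h2).1
  · rw [if_neg hw]
    split_ifs <;> first | omega | simp

theorem zip_ofFn {n : ℕ} (c i : Fin n → ℕ) :
    (List.ofFn c).zip (List.ofFn i) = List.ofFn fun x => (c x, i x) := by
  apply List.ext_getElem <;> simp

/-- The coloured series are permuted among themselves, by a rearrangement of the colours that does not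
depend on the function `f`. -/
theorem exists_permMap_zipSeries {n : ℕ} (δ : Equiv.Perm (Fin n)) (c : List ℕ) :
    ∃ c' : List ℕ, ∀ f : List (ℕ × ℕ) → ℚ, (∀ z z' : List (ℕ × ℕ), z.Perm z' → f z = f z') →
      permMap δ (zipSeries f c) = zipSeries f c' := by
  by_cases hc : c.length = n
  · subst hc
    refine ⟨List.ofFn (c.get ∘ δ.symm), fun f hf => ?_⟩
    ext w
    by_cases hw : w.length = c.length
    · obtain ⟨i, rfl⟩ : ∃ i : Fin c.length → ℕ, w = List.ofFn i :=
        ⟨fun j => w.get (j.cast hw.symm), by apply List.ext_getElem <;> simp [hw]⟩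
      have hz := zip_ofFn c.get fun j => i (δ j)
      rw [List.ofFn_get] at hz
      rw [permMap_apply_ofFn, zipSeries_apply, zipSeries_apply, if_pos (by simp), if_pos (by simp),
        zip_ofFn, hz]
      apply hf
      convert Equiv.Perm.ofFn_comp_perm δ (fun x => ((c.get ∘ δ.symm) x, i x)) using 2
      ext x <;> simp
    · simp [permMap, zipSeries_apply, hw]
  · refine ⟨c, fun f _ => ?_⟩
    ext w
    by_cases hw : w.length = n
    · simp [permMap, zipSeries_apply, hw, Ne.symm hc]
    · simp [permMap, hw]

/-! ### Coloured series as complete homogeneous and elementary functions -/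

/-- If the blocks of `ρ` are the level sets of `z`, then the block sizes are the multiplicities of the
values of `z`. -/
theorem shapeFactorial_eq_multFactorial {n : ℕ} {α : Type*} [DecidableEq α] (ρ : SetPartition n)
    (z : Fin n → α) (h : ∀ x y, z x = z y ↔ ρ.part x = ρ.part y) :
    (shapeFactorial ρ : ℚ) = multFactorial (List.ofFn z) := by
  choose r hr using fun B : ρ.parts => ρ.nonempty_of_mem_parts B.2
  have hpart : ∀ B : ρ.parts, ρ.part (r B) = B.1 := fun B => ρ.part_eq_of_mem B.2 (hr B)
  have himage : (List.ofFn z).toFinset = ρ.parts.attach.image fun B => z (r B) := by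
    ext p
    simp only [List.mem_toFinset, List.mem_ofFn, Finset.mem_image, Finset.mem_attach, true_and]
    constructor
    · rintro ⟨x, rfl⟩
      refine ⟨⟨ρ.part x, ρ.part_mem.2 (Finset.mem_univ _)⟩, ?_⟩
      rw [h, hpart]
    · rintro ⟨B, rfl⟩
      exact ⟨_, rfl⟩
  rw [shapeFactorial, multFactorial, himage, Finset.prod_image, Nat.cast_prod,
    ← Finset.prod_attach]
  · refine Finset.prod_congr rfl fun B _ => ?_
    congr 2
    rw [List.count_eq_countP, List.ofFn_eq_map, List.countP_map, List.countP_eq_length_filter,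
      ← List.toFinset_card_of_nodup ((List.nodup_finRange n).filter _)]
    congr 1
    ext y
    simp [h, hpart, ρ.part_eq_iff_mem B.2]
  · intro B _ C _ hBC
    rw [h, hpart, hpart] at hBC
    exact Subtype.ext hBC

theorem ncH_apply_ofFn {n : ℕ} (π : SetPartition n) (c i : Fin n → ℕ)
    (hc : ∀ x y, c x = c y ↔ π.part x = π.part y) :
    ncH π (List.ofFn i) = multFactorial (List.ofFn fun x => (c x, i x)) := by
  obtain ⟨σ, hσ⟩ := exists_same_kernel i
  rw [← shapeFactorial_eq_multFactorial (σ ⊓ π) _ fun x y => by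
      rw [part_inf_eq_iff, ← hσ, ← hc, Prod.mk.injEq, and_comm], ← ncH_blockWord]
  have h : ∀ τ : SetPartition n,
      ncM τ (List.ofFn i) = ncM τ (List.ofFn (blockWord σ)) := fun τ =>
    (homogSymm_ncM τ).apply_eq fun j k => by rw [hσ, blockWord_eq_iff]
  simp [ncH, NCSeries.sum_apply, h]

theorem ncE_apply_ofFn {n : ℕ} (π : SetPartition n) (c i : Fin n → ℕ)
    (hc : ∀ x y, c x = c y ↔ π.part x = π.part y) :
    ncE π (List.ofFn i) = nodupIndicator (List.ofFn fun x => (c x, i x)) := by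
  classical
  rw [ncE, wordSum_apply_ofFn, nodupIndicator]
  congr 1
  rw [List.nodup_ofFn, eq_iff_iff]
  constructor
  · intro h x y hxy
    by_contra hne
    rw [Prod.mk.injEq, hc] at hxy
    exact h x y hne hxy.1 hxy.2
  · intro h x y hne hxy hi
    exact hne (h (Prod.ext ((hc x y).2 hxy) hi))

/-- For a colouring whose colour classes are the blocks of `π`, the two coloured series are `h_π` and
`e_π`. -/
theorem zipSeries_eq {n : ℕ} (π : SetPartition n) (c : List ℕ) (hn : c.length = n)
    (hc : ∀ x y : Fin n, c.get (x.cast hn.symm) = c.get (y.cast hn.symm) ↔ π.part x = π.part y) :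
    zipSeries multFactorial c = ncH π ∧ zipSeries nodupIndicator c = ncE π := by
  subst hn
  constructor
  · ext w
    rw [zipSeries_apply]
    split_ifs with hw
    · obtain ⟨i, rfl⟩ : ∃ i : Fin c.length → ℕ, w = List.ofFn i :=
        ⟨fun j => w.get (j.cast hw.symm), by apply List.ext_getElem <;> simp [hw]⟩
      rw [ncH_apply_ofFn π c.get i hc, ← zip_ofFn, List.ofFn_get]
    · rw [ncH_of_length_ne π w hw]
  · ext w
    rw [zipSeries_apply]
    split_ifs with hw
    · obtain ⟨i, rfl⟩ : ∃ i : Fin c.length → ℕ, w = List.ofFn i :=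
        ⟨fun j => w.get (j.cast hw.symm), by apply List.ext_getElem <;> simp [hw]⟩
      rw [ncE_apply_ofFn π c.get i hc, ← zip_ofFn, List.ofFn_get]
    · rw [(homogSymm_ncE π).1 w hw]

theorem part_single {n : ℕ} (x y : Fin n) : (single n).part x = (single n).part y := by
  have h : ∀ z : Fin n, (single n).part z = Finset.univ := fun z =>
    Finset.mem_singleton.1 (Finpartition.parts_top_subset _ ((single n).part_mem.2 (by simp)))
  rw [h, h]

theorem zipSeries_replicate (k a : ℕ) :
    zipSeries multFactorial (List.replicate k a) = ncH (single k) ∧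
      zipSeries nodupIndicator (List.replicate k a) = ncE (single k) :=
  zipSeries_eq _ _ (by simp) fun x y => by simp [part_single x y]

theorem exists_zipSeries_eq (c : List ℕ) : ∃ π : SetPartition c.length,
    zipSeries multFactorial c = ncH π ∧ zipSeries nodupIndicator c = ncE π := by
  obtain ⟨π, hπ⟩ := exists_same_kernel c.get
  exact ⟨π, zipSeries_eq π c rfl fun x y => hπ x y⟩

/-! ### Determinants of complete homogeneous and elementary functions -/

/-- The series `h_[k] / k!`, and `0` if `k < 0`. -/
noncomputable def completeDiv (k : ℤ) : NCSeries :=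
  if k < 0 then 0 else (1 / (k.toNat ! : ℚ)) • ncH (single k.toNat)

/-- The series `e_[k] / k!`, and `0` if `k < 0`. -/
noncomputable def elementaryDiv (k : ℤ) : NCSeries :=
  if k < 0 then 0 else (1 / (k.toNat ! : ℚ)) • ncE (single k.toNat)

/-- The degrees `λᵢ - i + ε(i)` of the factors of the `ε`-th term of a Jacobi–Trudi determinant. -/
def rowDegrees {l : ℕ} (a : Fin l → ℕ) (ε : Equiv.Perm (Fin l)) : List ℤ :=
  List.ofFn fun i => (a i : ℤ) - (i : ℕ) + (ε i : ℕ)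

/-- The noncommutative Jacobi–Trudi determinant with entries `g (λᵢ - i + j)`. -/
noncomputable def jacobiTrudi (g : ℤ → NCSeries) {l : ℕ} (a : Fin l → ℕ) : NCSeries :=
  ∑ ε : Equiv.Perm (Fin l), Equiv.Perm.sign ε • ((rowDegrees a ε).map g).prod

theorem sourceSchur_eq_jacobiTrudi (l : List ℕ) :
    sourceSchur l = jacobiTrudi completeDiv l.get := by
  simp only [sourceSchur, ncDet, jacobiTrudi, rowDegrees, List.map_ofFn]
  rfl

/-- A product of series `h_[k] / k!` is a multiple of one coloured series, and the product of the
corresponding `e_[k] / k!` is the same multiple of the other one with the same colours: each factor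
gets a colour of its own. -/
theorem prod_eq_zipSeries {α : Type*} (L : List α) (col : α → ℕ) (deg : α → ℤ)
    (hL : (L.map col).Nodup) :
    ∃ (q : ℚ) (c : List ℕ), (∀ x ∈ c, x ∈ L.map col) ∧
      ((L.map deg).map completeDiv).prod = q • zipSeries multFactorial c ∧
      ((L.map deg).map elementaryDiv).prod = q • zipSeries nodupIndicator c := by
  induction L with
  | nil =>
    refine ⟨1, [], by simp, ?_, ?_⟩ <;>
    · ext w
      simp [zipSeries_apply, one_apply, multFactorial, nodupIndicator]
  | cons a L ih =>
    rw [List.map_cons, List.nodup_cons] at hL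
    obtain ⟨q, c, hc, h1, h2⟩ := ih hL.2
    simp only [List.map_cons, List.prod_cons, h1, h2]
    by_cases ha : deg a < 0
    · exact ⟨0, [], by simp, by simp [completeDiv, ha], by simp [elementaryDiv, ha]⟩
    · have hdisj : (List.replicate (deg a).toNat (col a)).Disjoint c := by
        intro x hx hxc
        rw [List.eq_of_mem_replicate hx] at hxc
        exact hL.1 (hc _ hxc)
      refine ⟨1 / ((deg a).toNat ! : ℚ) * q, List.replicate (deg a).toNat (col a) ++ c, ?_, ?_, ?_⟩
      · intro x hx
        rcases List.mem_append.1 hx with hx | hx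
        · simp [List.eq_of_mem_replicate hx]
        · exact List.mem_cons_of_mem _ (hc x hx)
      · rw [completeDiv, if_neg ha, ← (zipSeries_replicate _ (col a)).1, NCSeries.smul_mul,
          NCSeries.mul_smul, smul_smul, zipSeries_mul (fun _ _ => multFactorial_append) hdisj]
      · rw [elementaryDiv, if_neg ha, ← (zipSeries_replicate _ (col a)).2, NCSeries.smul_mul,
          NCSeries.mul_smul, smul_smul, zipSeries_mul (fun _ _ => nodupIndicator_append) hdisj]

/-- `ω` is compatible with products and with permutations of positions, for the terms of a
Jacobi–Trudi determinant. -/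
theorem ncOmega_permMap_prod {n l : ℕ} (δ : Equiv.Perm (Fin n)) (a : Fin l → ℕ)
    (ε : Equiv.Perm (Fin l)) :
    ∃ (h : permMap δ ((rowDegrees a ε).map completeDiv).prod ∈ NCSym),
      (ncOmega ⟨_, h⟩ : NCSeries) = permMap δ ((rowDegrees a ε).map elementaryDiv).prod := by
  have hr : rowDegrees a ε =
      (List.finRange l).map fun i => (a i : ℤ) - (i : ℕ) + (ε i : ℕ) := List.ofFn_eq_map
  obtain ⟨q, c, -, h1, h2⟩ := prod_eq_zipSeries (List.finRange l) Fin.val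
    (fun i => (a i : ℤ) - (i : ℕ) + (ε i : ℕ)) ((List.nodup_finRange l).map Fin.val_injective)
  obtain ⟨c', hc'⟩ := exists_permMap_zipSeries δ c
  obtain ⟨π, hH, hE⟩ := exists_zipSeries_eq c'
  rw [hr, h1, h2, map_smul, map_smul, hc' _ fun _ _ => multFactorial_perm,
    hc' _ fun _ _ => nodupIndicator_perm, hH, hE]
  refine ⟨Submodule.smul_mem _ _ (ncH_mem π), ?_⟩
  have hs : (⟨q • ncH π, Submodule.smul_mem _ _ (ncH_mem π)⟩ : NCSym) =
      q • ⟨ncH π, ncH_mem π⟩ := rfl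
  rw [hs, map_smul, ncOmega_ncH]
  rfl

/-- `ω` turns the `h`-determinant of `s_π` into the corresponding `e`-determinant. -/
theorem coe_ncOmega_ncSchur {n : ℕ} (π : SetPartition n) :
    (ncOmega (ncSchur π) : NCSeries) =
      permMap (readingPerm π) (jacobiTrudi elementaryDiv (shape π).get) := by
  choose h hω using ncOmega_permMap_prod (readingPerm π) (shape π).get
  have hs : ncSchur π = ∑ ε, (Equiv.Perm.sign ε : ℤ) • (⟨_, h ε⟩ : NCSym) := by
    apply Subtype.ext
    simp only [ncSchur, sourceSchur_eq_jacobiTrudi, jacobiTrudi, map_sum, Submodule.coe_sum,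
      AddSubgroupClass.coe_zsmul, Units.smul_def, map_zsmul]
  simp only [hs, map_sum, map_zsmul, Submodule.coe_sum, AddSubgroupClass.coe_zsmul, hω, jacobiTrudi,
    Units.smul_def]

/-! ### Coefficients of the elementary determinants -/

theorem elementaryDiv_of_length_ne (k : ℤ) (w : List ℕ) (h : (w.length : ℤ) ≠ k) :
    elementaryDiv k w = 0 := by
  rw [elementaryDiv]
  split_ifs with hk
  · rfl
  · rw [smul_apply, (homogSymm_ncE _).1 w (by omega), mul_zero]

theorem elementaryDiv_length (w : List ℕ) :
    elementaryDiv w.length w = 1 / (w.length ! : ℚ) * nodupIndicator w := by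
  rw [elementaryDiv, if_neg (by omega), Int.toNat_natCast, smul_apply,
    ← (zipSeries_replicate w.length 0).2, zipSeries_apply, if_pos (by simp)]
  congr 1
  have hz : (List.replicate w.length 0).zip w = w.map fun x => (0, x) := by
    apply List.ext_getElem <;> simp
  simp only [hz, nodupIndicator, List.nodup_map_iff (Prod.mk_right_injective 0)]

theorem elementaryDiv_zero : elementaryDiv 0 = 1 := by
  ext w
  cases w with
  | nil => simpa [nodupIndicator, one_apply] using elementaryDiv_length []
  | cons a w => rw [elementaryDiv_of_length_ne _ _ (by simp; omega)]; simp [one_apply]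

/-- A product `e_[k] f` is supported on words whose first `k` letters are distinct. -/
theorem elementaryDiv_mul_apply (k : ℕ) (f : NCSeries) (w : List ℕ) :
    (elementaryDiv k * f) w =
      if k ≤ w.length then 1 / (k ! : ℚ) * nodupIndicator (w.take k) * f (w.drop k) else 0 := by
  rw [mul_apply_of_degree (d := k) _ fun v hv =>
    elementaryDiv_of_length_ne _ _ (by exact_mod_cast hv)]
  split_ifs with h
  · have hk : ((w.take k).length : ℤ) = k := by rw [List.length_take, min_eq_left h]
    rw [← hk, elementaryDiv_length, List.length_take, min_eq_left h]
  · rfl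

theorem jacobiTrudi_apply (g : ℤ → NCSeries) {l : ℕ} (a : Fin l → ℕ) (w : List ℕ) :
    jacobiTrudi g a w = ∑ ε : Equiv.Perm (Fin l),
      ((Equiv.Perm.sign ε : ℤ) : ℚ) * ((rowDegrees a ε).map g).prod w := by
  simp only [jacobiTrudi, NCSeries.sum_apply, Units.smul_def, ← Int.cast_smul_eq_zsmul ℚ,
    smul_apply]

/-- If the first part is at least `2`, then in every term the first factor is `e_[k] / k!` with
`k ≥ 2`, which does not occur in a power of a single variable. -/
theorem jacobiTrudi_replicate_eq_zero {l : ℕ} (a : Fin (l + 1) → ℕ) (ha : 2 ≤ a 0) (n : ℕ) :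
    jacobiTrudi elementaryDiv a (List.replicate n 0) = 0 := by
  rw [jacobiTrudi_apply]
  refine Finset.sum_eq_zero fun ε _ => ?_
  have hd : (a 0 : ℤ) - ((0 : Fin (l + 1)) : ℕ) + (ε 0 : ℕ) = ((a 0 + ε 0 : ℕ) : ℤ) := by
    simp
  rw [rowDegrees, List.ofFn_succ, List.map_cons, List.prod_cons, hd, elementaryDiv_mul_apply]
  split_ifs with hn
  · have hz : nodupIndicator ((List.replicate n 0).take (a 0 + ε 0)) = 0 := by
      rw [nodupIndicator, if_neg]
      rw [List.take_replicate, List.nodup_replicate]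
      simp only [List.length_replicate] at hn
      omega
    rw [hz, mul_zero, zero_mul, mul_zero]
  · rw [mul_zero]

/-- Products of the `e_[k] / k!` are homogeneous of degree the sum of the indices. -/
theorem sum_eq_length_of_prod_apply_ne_zero (ds : List ℤ) (w : List ℕ)
    (h : (ds.map elementaryDiv).prod w ≠ 0) : ds.sum = w.length := by
  induction ds generalizing w with
  | nil =>
    rw [List.map_nil, List.prod_nil, one_apply] at h
    have : w = [] := by_contra fun hw => h (if_neg hw)
    simp [this]
  | cons d ds ih =>
    rw [List.map_cons, List.prod_cons] at h
    by_cases hd : d < 0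
    · simp [elementaryDiv, hd] at h
    · lift d to ℕ using by omega
      rw [elementaryDiv_mul_apply] at h
      split_ifs at h with hw
      · rw [List.sum_cons, ih _ (right_ne_zero_of_mul h), List.length_drop]
        omega
      · exact absurd rfl h

theorem eq_length_of_jacobiTrudi_one_ne_zero {l : ℕ} (w : List ℕ)
    (h : jacobiTrudi elementaryDiv (fun _ : Fin l => 1) w ≠ 0) : l = w.length := by
  rw [jacobiTrudi_apply] at h
  obtain ⟨ε, -, hε⟩ := Finset.exists_ne_zero_of_sum_ne_zero h
  have hs := sum_eq_length_of_prod_apply_ne_zero _ _ (right_ne_zero_of_mul hε)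
  rw [rowDegrees, List.sum_ofFn, Finset.sum_add_distrib, Finset.sum_sub_distrib,
    Equiv.sum_comp ε fun i : Fin l => ((i : ℕ) : ℤ)] at hs
  simpa using hs

/-- On words that begin with a repeated letter, only the terms with `ε(1) = 1` contribute to the
determinant of shape `1ˡ⁺¹`: otherwise the first factor is an `e_[k] / k!`, `k ≥ 2`, to be evaluated
at a word with a repeated letter. -/
theorem jacobiTrudi_one_cons_cons (l b : ℕ) (w : List ℕ) :
    jacobiTrudi elementaryDiv (fun _ : Fin (l + 1) => 1) (b :: b :: w) =
      jacobiTrudi elementaryDiv (fun _ : Fin l => 1) (b :: w) := by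
  rw [jacobiTrudi_apply, jacobiTrudi_apply, ← Equiv.sum_comp Equiv.Perm.decomposeFin.symm,
    Fintype.sum_prod_type]
  have hcons : ∀ (p : Fin (l + 1)) (e : Equiv.Perm (Fin l)), ∃ ds : List ℤ,
      rowDegrees (fun _ => 1) (Equiv.Perm.decomposeFin.symm (p, e)) =
        ((1 + p : ℕ) : ℤ) :: ds ∧ (p = 0 → ds = rowDegrees (fun _ => 1) e) := by
    intro p e
    refine ⟨_, by
      rw [rowDegrees, List.ofFn_succ, Equiv.Perm.decomposeFin_symm_apply_zero]; simp; rfl, ?_⟩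
    rintro rfl
    rw [rowDegrees]
    congr 1
    funext i
    simp
    ring
  -- `p` is the column chosen in the first row, and the first factor has degree `1 + p`.
  rw [Finset.sum_eq_single_of_mem 0 (Finset.mem_univ _)]
  · refine Finset.sum_congr rfl fun e _ => ?_
    obtain ⟨ds, h1, h2⟩ := hcons 0 e
    rw [h1, h2 rfl, Equiv.Perm.decomposeFin.symm_sign, List.map_cons, List.prod_cons,
      elementaryDiv_mul_apply]
    simp [nodupIndicator]
  · intro p _ hp
    refine Finset.sum_eq_zero fun e _ => ?_
    obtain ⟨ds, h1, -⟩ := hcons p e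
    obtain ⟨q, hq⟩ : ∃ q : ℕ, 1 + (p : ℕ) = q + 2 :=
      ⟨p - 1, by have : (p : ℕ) ≠ 0 := fun h => hp (Fin.ext h)
                 omega⟩
    rw [h1, List.map_cons, List.prod_cons, elementaryDiv_mul_apply, hq]
    simp [nodupIndicator]

theorem jacobiTrudi_one_apply (l : ℕ) :
    jacobiTrudi elementaryDiv (fun _ : Fin (l + 2) => 1) (List.replicate (l + 1) 0 ++ [1]) =
      1 / 2 := by
  induction l with
  | zero =>
    -- The two terms of the `2 × 2` determinant are `e_[1] e_[1]` and `-e_[2] e_[0] / 2`.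
    have h11 : (elementaryDiv 1 * elementaryDiv 1) [0, 1] = 1 := by
      have := elementaryDiv_mul_apply 1 (elementaryDiv 1) [0, 1]
      have h1 := elementaryDiv_length [1]
      simp [nodupIndicator] at this h1
      rw [this, h1]
    have h20 : (elementaryDiv 2 * elementaryDiv 0) [0, 1] = 1 / 2 := by
      have := elementaryDiv_mul_apply 2 (elementaryDiv 0) [0, 1]
      simp [nodupIndicator, elementaryDiv_zero, one_apply] at this
      simpa [elementaryDiv_zero] using this
    rw [jacobiTrudi_apply]
    have hu : (Finset.univ : Finset (Equiv.Perm (Fin 2))) = {1, Equiv.swap 0 1} := by decide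
    rw [zero_add, hu, Finset.sum_pair (by decide)]
    simp [rowDegrees, List.ofFn_succ, h11, h20]
    norm_num
  | succ l ih =>
    rw [← ih]
    exact jacobiTrudi_one_cons_cons (l + 2) 0 (List.replicate l 0 ++ [1])

/-! ### The one-block Schur function -/

theorem shape_single {n : ℕ} (hn : n ≠ 0) : shape (single n) = [n] := by
  have hp : (single n).parts = {Finset.univ} := by
    have hs := Finpartition.parts_top_subset (Finset.univ : Finset (Fin n))
    refine (Finset.subset_singleton_iff.1 hs).resolve_left fun h => ?_
    have := (Finpartition.part_mem (single n)).2 (Finset.mem_univ (⟨0, by omega⟩ : Fin n))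
    rw [single, h] at this
    simp at this
  simp [shape, hp]

theorem exists_perm_permMap_apply {n : ℕ} (δ : Equiv.Perm (Fin n)) (w : List ℕ) :
    ∃ w' : List ℕ, w'.Perm w ∧ ∀ f, permMap δ f w = f w' := by
  by_cases hw : w.length = n
  · subst hw
    refine ⟨List.ofFn fun j => w.get (δ j), ?_, fun f => by simp [permMap]⟩
    have h := Equiv.Perm.ofFn_comp_perm δ w.get
    rwa [List.ofFn_get] at h
  · exact ⟨w, List.Perm.refl w, fun f => by simp [permMap, hw]⟩

theorem exists_perm_apply_permMap {n : ℕ} (δ : Equiv.Perm (Fin n)) (w : List ℕ) :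
    ∃ w' : List ℕ, w'.Perm w ∧ ∀ f, permMap δ f w' = f w := by
  by_cases hw : w.length = n
  · subst hw
    refine ⟨List.ofFn fun j => w.get (δ.symm j), ?_, fun f => ?_⟩
    · have h := Equiv.Perm.ofFn_comp_perm δ.symm w.get
      rwa [List.ofFn_get] at h
    · rw [permMap_apply_ofFn]
      simp
  · exact ⟨w, List.Perm.refl w, fun f => by simp [permMap, hw]⟩

/-- `s_[n]` is `h_[n] / n!`; it is symmetric in the positions, so the permutation `δ_[n]` plays no
role. -/
theorem ncSchur_single_apply (w : List ℕ) (hw : w ≠ []) :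
    (ncSchur (single w.length) : NCSeries) w = 1 / (w.length ! : ℚ) * multFactorial w := by
  have hw' : w.length ≠ 0 := by simpa using hw
  obtain ⟨w', hp, h⟩ := exists_perm_permMap_apply (readingPerm (single w.length)) w
  have hs : ∀ k : ℕ, sourceSchur [k] = completeDiv k := by
    intro k
    rw [sourceSchur_eq_jacobiTrudi, jacobiTrudi]
    simp [rowDegrees]
  have hz : (List.replicate w.length 0).zip w' = w'.map fun x => (0, x) := by
    apply List.ext_getElem <;> simp [hp.length_eq]
  rw [ncSchur]
  simp only [h]
  rw [shape_single hw', hs, completeDiv, if_neg (by omega), Int.toNat_natCast, smul_apply,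
    ← (zipSeries_replicate w.length 0).1, zipSeries_apply, if_pos (by simp [hp.length_eq]), hz,
    multFactorial_perm (hp.map _)]
  rw [multFactorial_map (Prod.mk_right_injective 0)]

/-- A weakly decreasing shape whose determinant involves a power of a single variable has no part
larger than `1`. -/
theorem le_one_of_jacobiTrudi_replicate_ne_zero (l : List ℕ) (hl : l.SortedGE) (n : ℕ)
    (h : jacobiTrudi elementaryDiv l.get (List.replicate n 0) ≠ 0) : ∀ x ∈ l, x ≤ 1 := by
  cases l with
  | nil => simp
  | cons a l =>
    have ha : a ≤ 1 := by
      by_contra ha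
      exact h (jacobiTrudi_replicate_eq_zero _ (by simp; omega) n)
    intro x hx
    rcases List.mem_cons.1 hx with rfl | hx
    · exact ha
    · exact (List.rel_of_pairwise_cons hl.pairwise hx).trans ha

theorem ncSchur_single_ne_ncOmega {n : ℕ} (hn : 3 ≤ n) {m : ℕ} (π : SetPartition m) :
    ncSchur (single n) ≠ ncOmega (ncSchur π) := by
  intro heq
  have hS : ∀ w, (ncSchur (single n) : NCSeries) w =
      permMap (readingPerm π) (jacobiTrudi elementaryDiv (shape π).get) w := by
    intro w
    rw [heq, coe_ncOmega_ncSchur]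
  -- At `x₀ⁿ` the left side is `1`, so all parts of the shape are `1` and there are `n` of them.
  have h0 : jacobiTrudi elementaryDiv (shape π).get (List.replicate n 0) ≠ 0 := by
    obtain ⟨w, hw, h⟩ := exists_perm_permMap_apply (readingPerm π) (List.replicate n 0)
    rw [List.perm_replicate] at hw
    have h1 := ncSchur_single_apply (List.replicate n 0) (by simp; omega)
    rw [List.length_replicate, hS, h, hw, multFactorial_replicate] at h1
    rw [h1]
    positivity
  have hone : ∀ x ∈ shape π, x = 1 := by
    intro x hx
    refine le_antisymm (le_one_of_jacobiTrudi_replicate_ne_zero _ ?_ n h0 x hx) ?_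
    · exact (Multiset.pairwise_sort _ _).sortedGE
    · rw [shape, Multiset.mem_sort] at hx
      obtain ⟨B, hB, rfl⟩ := Multiset.mem_map.1 hx
      exact (π.nonempty_of_mem_parts hB).card_pos
  have hget : (shape π).get = fun _ => 1 := funext fun i => hone _ (List.get_mem _ i)
  rw [hget] at h0 hS
  have hlen := eq_length_of_jacobiTrudi_one_ne_zero _ h0
  rw [List.length_replicate] at hlen
  obtain ⟨l, hl⟩ : ∃ l, n = l + 2 := ⟨n - 2, by omega⟩
  -- At `x₀ⁿ⁻¹ x₁`, up to order, the left side is `1 / n` and the right side is `1 / 2`.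
  obtain ⟨w, hw, h⟩ := exists_perm_apply_permMap (readingPerm π) (List.replicate (l + 1) 0 ++ [1])
  have hwlen : w.length = n := by rw [hw.length_eq, hl]; simp
  have h1 := ncSchur_single_apply w (by rintro rfl; simp at hwlen; omega)
  have h2 := jacobiTrudi_one_apply l
  rw [← hl, ← hlen] at h2
  rw [hwlen, hS, h, h2, multFactorial_perm hw, multFactorial_append (by simp),
    multFactorial_replicate] at h1
  have h3 := multFactorial_replicate 1 1
  rw [List.replicate_one, Nat.factorial_one] at h3
  rw [h3, hl, Nat.factorial_succ (l + 1)] at h1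
  have hpos : ((l + 1)! : ℚ) ≠ 0 := by positivity
  push_cast at h1
  field_simp at h1
  have h4 : (l : ℚ) = 0 := by linarith
  have h5 : l = 0 := by exact_mod_cast h4
  omega

theorem proposition4p5 :
    {f : NCSym | ∃ n : ℕ, 1 ≤ n ∧ ∃ π : SetPartition n, f = ncSchur π} ≠
        {f : NCSym | ∃ n : ℕ, 1 ≤ n ∧ ∃ π : SetPartition n, f = ncSchurTransposed π} ∧
      ∀ n : ℕ, 3 ≤ n → ∀ (m : ℕ) (π : SetPartition m),
        ncSchur (SetPartition.single n) ≠ ncOmega (ncSchur π) := by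
  refine ⟨fun h => ?_, fun n hn m π => ncSchur_single_ne_ncOmega hn π⟩
  have h3 : ncSchur (single 3) ∈
      {f : NCSym | ∃ n : ℕ, 1 ≤ n ∧ ∃ π : SetPartition n, f = ncSchur π} :=
    ⟨3, by norm_num, single 3, rfl⟩
  rw [h] at h3
  obtain ⟨m, -, π, hπ⟩ := h3
  exact ncSchur_single_ne_ncOmega le_rfl π hπ
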